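/- Let $G\subsetneq\mathbb{R}^n$ be a domain and write $d_G(x)=d(x,\partial G)$ for $x\in G$. For $x,y\in G$ let $$k_G(x,y)=\inf_\gamma\int_\gamma\frac{|dz|}{d_G(z)},\qquad j_G(x,y)=\log\left(1+\frac{|x-y|}{\min\{d_G(x),d_G(y)\}}\right),$$ where the infimum is taken over all rectifiable curves $\gamma$ joining $x$ and $y$ in $G$. The uniformity constant of $G$ is $$A_G=\inf\{A\ge 1 : k_G(x,y)\le A\,j_G(x,y)\text{ for all }x,y\in G\},$$ with $\inf\emptyset=\infty$. **Theorem 1.7 (UC in triangle).** Let $T\subset\mathbb{R}^2$ be the interior of a non-degenerate triangle with angles $\alpha$, $\beta$ and $\gamma$ such that $\alpha\le\beta\le\gamma$. Then $$A_T\ge\frac{1}{\sin\frac{\alpha}{2}}+\frac{1}{\sin\frac{\beta}{2}}.$$ -/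

import Mathlib

open MeasureTheory

noncomputable section

namespace QuasihyperbolicUC

variable {n : ℕ}

/-- The boundary distance `d_G(x) = d(x, ∂G)`. -/
def bdryDist (G : Set (EuclideanSpace ℝ (Fin n))) (x : EuclideanSpace ℝ (Fin n)) : ℝ :=
  Metric.infDist x (frontier G)

/-- A curve is rectifiable if its length, i.e. its total variation, is finite. -/
def Rectifiable {x y : EuclideanSpace ℝ (Fin n)} (γ : Path x y) : Prop :=
  BoundedVariationOn γ Set.univ

/-- The length of a curve. It is the true length when the curve is rectifiable. -/
def curveLength {x y : EuclideanSpace ℝ (Fin n)} (γ : Path x y) : ℝ :=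
  (eVariationOn γ Set.univ).toReal

/-- The arc-length parametrization of a rectifiable curve; it is used on `[0, curveLength γ]`. -/
def arcLengthParam {x y : EuclideanSpace ℝ (Fin n)} (γ : Path x y) :
    ℝ → EuclideanSpace ℝ (Fin n) :=
  naturalParameterization γ Set.univ 0

/-- The quasihyperbolic length `ℓ_k(γ) = ∫_γ |dx| / d_G(x)` of a rectifiable curve `γ` in `G`:
the integral of `1 / d_G` with respect to arc length, with values in `[0, ∞]`. -/
def qhLength (G : Set (EuclideanSpace ℝ (Fin n))) {x y : EuclideanSpace ℝ (Fin n)}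
    (γ : Path x y) : ENNReal :=
  ∫⁻ s in Set.Icc 0 (curveLength γ), (ENNReal.ofReal (bdryDist G (arcLengthParam γ s)))⁻¹

/-- The quasihyperbolic distance `k_G(x, y)`: the infimum of the quasihyperbolic lengths of all
rectifiable curves joining `x` and `y` in `G` (with value `∞` if there are none). -/
def qhDist (G : Set (EuclideanSpace ℝ (Fin n))) (x y : EuclideanSpace ℝ (Fin n)) : ENNReal :=
  sInf {l | ∃ γ : Path x y, Set.range γ ⊆ G ∧ Rectifiable γ ∧ l = qhLength G γ}

/-- The distance ratio metric `j_G(x, y) = log (1 + |x - y| / min {d_G(x), d_G(y)})`,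
for `x` and `y` in `G`. -/
def distRatio (G : Set (EuclideanSpace ℝ (Fin n))) (x y : EuclideanSpace ℝ (Fin n)) : ℝ :=
  Real.log (1 + ‖x - y‖ / min (bdryDist G x) (bdryDist G y))

/-- The uniformity constant
`A_G = inf {A ≥ 1 : k_G(x, y) ≤ A j_G(x, y) for all x, y in G}`, an infimum of real numbers taken
in the extended reals, so that `A_G = ∞` exactly if `G` is not uniform. -/
def uniformityConstant (G : Set (EuclideanSpace ℝ (Fin n))) : EReal :=
  sInf {a | ∃ A : ℝ, 1 ≤ A ∧
    (∀ x ∈ G, ∀ y ∈ G, qhDist G x y ≤ ENNReal.ofReal (A * distRatio G x y)) ∧ a = (A : EReal)}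

/-- The (open) triangle with vertices `P`, `Q`, `R`, as a plane domain. -/
def triangleDomain (P Q R : EuclideanSpace ℝ (Fin 2)) : Set (EuclideanSpace ℝ (Fin 2)) :=
  interior (convexHull ℝ {P, Q, R})

end QuasihyperbolicUC

end

/-!
The bound is asymptotic: it comes from pairs of points `x` and `y` that approach the two vertices
`P` and `Q` at the same rate. Let `I` be a point of the triangle `T` and let `x`, `y` be the images
of `I` under the homotheties of ratio `t` centred at `P` and at `Q`. By convexity `d_T(x)` and
`d_T(y)` are at least `t * d_T(I)`, so that `j_T(x, y) ≤ log (1 / t) + O(1)`.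

On the other side, a point `z` of `T` satisfies `d_T(z) ≤ |z - P| sin (α / 2)`, since the nearer of
the two side lines through `P` lies within an angle `α / 2` of `z`
(`bdryDist_triangleDomain_le`); likewise at `Q`. A curve from `x` to `y` has to leave a ball of fixed
radius `ρ` around `P` and to enter the disjoint ball of radius `ρ` around `Q`, and this costs
quasihyperbolic length at least `log (1 / t) / sin (α / 2) - O(1)` and
`log (1 / t) / sin (β / 2) - O(1)` respectively. This is expressed by the potential
`log (min |z - P| ρ) / sin (α / 2) - log (min |z - Q| ρ) / sin (β / 2)`, whose local slope is at most
`1 / d_T` because at every point one of its two terms is locally constant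
(`twoPointPotential_sub_le`). The increment of such a potential along a curve is bounded by the
quasihyperbolic length (`ofReal_sub_le_qhLength`), for which the curve is traversed by arc length.
Dividing by `log (1 / t)` and letting `t` tend to `0` gives the claim.
-/

open Set Filter Topology

namespace QuasihyperbolicUC

variable {n : ℕ}

/-! ### The arc-length parametrization of a rectifiable path -/

section ArcLength

variable {x y : EuclideanSpace ℝ (Fin n)} {γ : Path x y}

theorem arcLengthParam_mem_range (γ : Path x y) (s : ℝ) : arcLengthParam γ s ∈ range γ :=
  ⟨_, rfl⟩

/-- The variation of a continuous rectifiable curve has no jumps, hence is continuous. -/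
theorem Rectifiable.continuous_variationOnFromTo (hγ : Rectifiable γ) :
    Continuous (variationOnFromTo γ univ 0) := by
  have hγ' : BoundedVariationOn γ univ := hγ
  have hl := hγ'.locallyBoundedVariationOn
  rw [continuous_iff_continuousAt]
  intro b
  rw [continuousAt_iff_continuous_left'_right']
  have hL := variationOnFromTo.tendsto_left (a := 0) (b := b) (mem_univ _) (mem_univ _) hl
    (l := γ b) (γ.continuous.continuousAt.mono_left nhdsWithin_le_nhds)
  have hR := variationOnFromTo.tendsto_right (a := 0) (b := b) (mem_univ _) (mem_univ _) hl
    (l := γ b) (γ.continuous.continuousAt.mono_left nhdsWithin_le_nhds)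
  simp only [univ_inter, dist_self, sub_zero, add_zero] at hL hR
  exact ⟨hL, hR⟩

theorem variationOnFromTo_zero_one (γ : Path x y) :
    variationOnFromTo γ univ 0 1 = curveLength γ := by
  have h : univ ∩ Icc (0 : unitInterval) 1 = univ := by
    ext t
    simp [unitInterval.le_one']
  rw [variationOnFromTo.eq_of_le _ _ zero_le_one, h, curveLength]

theorem Rectifiable.image_variationOnFromTo (hγ : Rectifiable γ) :
    variationOnFromTo γ univ 0 '' univ = Icc 0 (curveLength γ) := by
  have hl := BoundedVariationOn.locallyBoundedVariationOn hγ
  have hmono := variationOnFromTo.monotoneOn hl (mem_univ (0 : unitInterval))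
  apply Subset.antisymm
  · rintro _ ⟨t, -, rfl⟩
    refine ⟨variationOnFromTo.nonneg_of_le _ _ unitInterval.nonneg', ?_⟩
    rw [← variationOnFromTo_zero_one]
    exact hmono (mem_univ _) (mem_univ _) unitInterval.le_one'
  · have := intermediate_value_univ (0 : unitInterval) 1 hγ.continuous_variationOnFromTo
    rwa [variationOnFromTo.self, variationOnFromTo_zero_one, ← image_univ] at this

theorem Rectifiable.lipschitzOnWith_arcLengthParam (hγ : Rectifiable γ) :
    LipschitzOnWith 1 (arcLengthParam γ) (Icc 0 (curveLength γ)) := by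
  have hl := BoundedVariationOn.locallyBoundedVariationOn hγ
  have hu := has_unit_speed_naturalParameterization γ hl (mem_univ (0 : unitInterval))
  rw [hγ.image_variationOnFromTo] at hu
  have key : ∀ s ∈ Icc 0 (curveLength γ), ∀ t ∈ Icc 0 (curveLength γ), s ≤ t →
      edist (arcLengthParam γ s) (arcLengthParam γ t) ≤ edist s t := by
    intro s hs t ht hst
    calc edist (arcLengthParam γ s) (arcLengthParam γ t)
        ≤ eVariationOn (arcLengthParam γ) (Icc 0 (curveLength γ) ∩ Icc s t) :=
          eVariationOn.edist_le _ ⟨hs, le_rfl, hst⟩ ⟨ht, hst, le_rfl⟩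
      _ = ENNReal.ofReal (t - s) := by
          rw [arcLengthParam, hu hs ht, NNReal.coe_one, one_mul]
      _ = edist s t := by
          rw [edist_comm, edist_dist, Real.dist_eq, abs_of_nonneg (sub_nonneg.2 hst)]
  intro s hs t ht
  rw [ENNReal.coe_one, one_mul]
  rcases le_total s t with h | h
  · exact key s hs t ht h
  · rw [edist_comm, edist_comm s]
    exact key t ht s hs h

theorem Rectifiable.arcLengthParam_variationOnFromTo (hγ : Rectifiable γ) (t : unitInterval) :
    arcLengthParam γ (variationOnFromTo γ univ 0 t) = γ t :=
  edist_eq_zero.1 (edist_naturalParameterization_eq_zero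
    (BoundedVariationOn.locallyBoundedVariationOn hγ) (mem_univ _) (mem_univ _))

theorem Rectifiable.arcLengthParam_zero (hγ : Rectifiable γ) : arcLengthParam γ 0 = x := by
  simpa [variationOnFromTo.self] using hγ.arcLengthParam_variationOnFromTo 0

theorem Rectifiable.arcLengthParam_curveLength (hγ : Rectifiable γ) :
    arcLengthParam γ (curveLength γ) = y := by
  simpa [variationOnFromTo_zero_one] using hγ.arcLengthParam_variationOnFromTo 1

end ArcLength

/-! ### Boundary distance -/

section BdryDist

variable {G : Set (EuclideanSpace ℝ (Fin n))} {z f : EuclideanSpace ℝ (Fin n)}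

theorem continuous_bdryDist (G : Set (EuclideanSpace ℝ (Fin n))) : Continuous (bdryDist G) :=
  Metric.continuous_infDist_pt _

theorem bdryDist_le_dist (hz : z ∈ G) (hf : f ∉ G) : bdryDist G z ≤ dist z f := by
  obtain ⟨w, hw, hwd⟩ := exists_mem_frontier_infDist_compl_eq_dist hz
    (ne_univ_iff_exists_notMem G |>.2 ⟨f, hf⟩)
  calc bdryDist G z ≤ dist z w := Metric.infDist_le_dist_of_mem hw
    _ = Metric.infDist z Gᶜ := hwd.symm
    _ ≤ dist z f := Metric.infDist_le_dist_of_mem hf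

theorem le_bdryDist_of_ball_subset {r : ℝ} (hr : 0 < r) (h : Metric.ball z r ⊆ G) (hf : f ∉ G) :
    r ≤ bdryDist G z := by
  obtain ⟨w, hw, -⟩ := exists_mem_frontier_infDist_compl_eq_dist (h (Metric.mem_ball_self hr))
    (ne_univ_iff_exists_notMem G |>.2 ⟨f, hf⟩)
  refine (Metric.le_infDist ⟨w, hw⟩).2 fun v hv => ?_
  by_contra! hlt
  refine hv.2 (interior_mono h ?_)
  rw [Metric.isOpen_ball.interior_eq]
  rwa [Metric.mem_ball, dist_comm]

theorem bdryDist_pos (hG : IsOpen G) (hz : z ∈ G) (hf : f ∉ G) : 0 < bdryDist G z := by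
  obtain ⟨r, hr, h⟩ := Metric.isOpen_iff.1 hG z hz
  exact hr.trans_le (le_bdryDist_of_ball_subset hr h hf)

end BdryDist

/-! ### Lower bounds for quasihyperbolic length by potentials -/

/-- A continuous function whose increments are locally at most the increment of the variable times
the larger value of `φ` at the two ends grows by at most the integral of `φ`. -/
theorem sub_le_integral_of_local_slope_le {F φ : ℝ → ℝ} {a b : ℝ} (hab : a ≤ b)
    (hF : ContinuousOn F (Icc a b)) (hφ : ContinuousOn φ (Icc a b))
    (h : ∀ s ∈ Ico a b, ∀ᶠ t in 𝓝[>] s, F t - F s ≤ (t - s) * max (φ s) (φ t)) :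
    F b - F a ≤ ∫ s in a..b, φ s := by
  have hint : IntervalIntegrable φ volume a b := hφ.intervalIntegrable_of_Icc hab
  have hB : ∀ s ∈ Ico a b,
      HasDerivWithinAt (fun t => F a + ∫ r in a..t, φ r) (φ s) (Ici s) s := by
    intro s hs
    have hs' : Icc a b ∈ 𝓝[>] s := mem_of_superset (Ioc_mem_nhdsGT hs.2) fun r hr =>
      ⟨hs.1.trans hr.1.le, hr.2⟩
    have hcont : ContinuousWithinAt φ (Ioi s) s :=
      (hφ s ⟨hs.1, hs.2.le⟩).mono_of_mem_nhdsWithin hs'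
    refine HasDerivWithinAt.const_add _ ?_
    refine intervalIntegral.integral_hasDerivWithinAt_right
      (hint.mono_set ?_) (t := Ioi s) ?_ hcont
    · rw [uIcc_of_le hs.1, uIcc_of_le hab]
      exact Icc_subset_Icc_right hs.2.le
    · exact ⟨Icc a b, hs', hφ.aestronglyMeasurable measurableSet_Icc⟩
  have hBc : ContinuousOn (fun t => F a + ∫ r in a..t, φ r) (Icc a b) := by
    refine continuousOn_const.add ?_
    have := intervalIntegral.continuousOn_primitive_interval
      (μ := volume) (f := φ) (a := a) (b := b) ?_
    · rwa [uIcc_of_le hab] at this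
    · rw [uIcc_of_le hab]
      exact hφ.integrableOn_Icc
  have := image_le_of_liminf_slope_right_le_deriv_boundary hF (by simp) hBc hB ?_
    (right_mem_Icc.2 hab)
  · linarith
  intro s hs r hr
  have hs' : Icc a b ∈ 𝓝[>] s := mem_of_superset (Ioc_mem_nhdsGT hs.2) fun r hr =>
    ⟨hs.1.trans hr.1.le, hr.2⟩
  have hcont : Tendsto φ (𝓝[>] s) (𝓝 (φ s)) :=
    (hφ s ⟨hs.1, hs.2.le⟩).mono_of_mem_nhdsWithin hs'
  refine Eventually.frequently ?_
  filter_upwards [h s hs, hcont.eventually (gt_mem_nhds hr), self_mem_nhdsWithin]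
    with t ht htr hst
  have hst' : 0 < t - s := sub_pos.2 hst
  rw [slope_def_field, div_lt_iff₀ hst']
  calc F t - F s ≤ (t - s) * max (φ s) (φ t) := ht
    _ < (t - s) * r := mul_lt_mul_of_pos_left (max_lt hr htr) hst'
    _ = r * (t - s) := mul_comm _ _

/-- If the slope of `U` is locally bounded by the quasihyperbolic density `1 / d_G`, then the
increment of `U` along a rectifiable curve is at most the quasihyperbolic length of the curve. -/
theorem ofReal_sub_le_qhLength {G : Set (EuclideanSpace ℝ (Fin n))}
    {x y : EuclideanSpace ℝ (Fin n)} {γ : Path x y} (hγ : Rectifiable γ) (hγG : range γ ⊆ G)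
    (hpos : ∀ z ∈ G, 0 < bdryDist G z) {U : EuclideanSpace ℝ (Fin n) → ℝ}
    (hU : ContinuousOn U G)
    (h : ∀ z ∈ G, ∀ᶠ w in 𝓝[G] z,
      U w - U z ≤ dist w z * max (bdryDist G z)⁻¹ (bdryDist G w)⁻¹) :
    ENNReal.ofReal (U y - U x) ≤ qhLength G γ := by
  set L := curveLength γ with hL
  have hL0 : 0 ≤ L := ENNReal.toReal_nonneg
  set g := arcLengthParam γ with hg
  have hgG : ∀ s, g s ∈ G := fun s => hγG (arcLengthParam_mem_range γ s)
  have hlip : LipschitzOnWith 1 g (Icc 0 L) := hγ.lipschitzOnWith_arcLengthParam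
  have hgc : ContinuousOn g (Icc 0 L) := hlip.continuousOn
  have hφ : ContinuousOn (fun s => (bdryDist G (g s))⁻¹) (Icc 0 L) :=
    ((continuous_bdryDist G).comp_continuousOn hgc).inv₀ fun s _ => (hpos _ (hgG s)).ne'
  have hUg : ContinuousOn (fun s => U (g s)) (Icc 0 L) := hU.comp hgc fun s _ => hgG s
  have hmain := sub_le_integral_of_local_slope_le hL0 hUg hφ ?_
  · have h0 : g 0 = x := hγ.arcLengthParam_zero
    have h1 : g L = y := hγ.arcLengthParam_curveLength
    rw [h0, h1, intervalIntegral.integral_of_le hL0, ← integral_Icc_eq_integral_Ioc] at hmain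
    refine (ENNReal.ofReal_le_ofReal hmain).trans_eq ?_
    rw [ofReal_integral_eq_lintegral_ofReal hφ.integrableOn_Icc
      (ae_of_all _ fun s => inv_nonneg.2 (hpos _ (hgG s)).le), qhLength]
    exact lintegral_congr fun s => ENNReal.ofReal_inv_of_pos (hpos _ (hgG s))
  · intro s hs
    have hs' : Icc 0 L ∈ 𝓝[>] s := mem_of_superset (Ioc_mem_nhdsGT hs.2) fun r hr =>
      ⟨hs.1.trans hr.1.le, hr.2⟩
    have htend : Tendsto g (𝓝[>] s) (𝓝[G] (g s)) :=
      tendsto_nhdsWithin_iff.2 ⟨(hgc s ⟨hs.1, hs.2.le⟩).mono_of_mem_nhdsWithin hs',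
        Eventually.of_forall hgG⟩
    filter_upwards [htend.eventually (h _ (hgG s)), hs', self_mem_nhdsWithin] with t ht htI hst
    refine ht.trans (mul_le_mul_of_nonneg_right ?_ ?_)
    · have := hlip.dist_le_mul t htI s ⟨hs.1, hs.2.le⟩
      rwa [NNReal.coe_one, one_mul, Real.dist_eq, abs_of_pos (sub_pos.2 hst)] at this
    · exact le_max_of_le_left (inv_nonneg.2 (hpos _ (hgG s)).le)

theorem log_min_sub_log_min_le {a b ρ : ℝ} (ha : 0 < a) (hb : 0 < b) (hρ : 0 < ρ) :
    Real.log (min b ρ) - Real.log (min a ρ) ≤ |b - a| / a := by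
  have hbρ : 0 < min b ρ := lt_min hb hρ
  rcases le_total a ρ with h | h
  · rw [min_eq_left h, ← Real.log_div hbρ.ne' ha.ne']
    calc Real.log (min b ρ / a) ≤ min b ρ / a - 1 := Real.log_le_sub_one_of_pos (by positivity)
      _ ≤ b / a - 1 := by gcongr; exact min_le_left _ _
      _ = (b - a) / a := by field_simp
      _ ≤ |b - a| / a := by gcongr; exact le_abs_self _
  · rw [min_eq_right h]
    have : Real.log (min b ρ) ≤ Real.log ρ := Real.log_le_log hbρ (min_le_right _ _)
    have : 0 ≤ |b - a| / a := by positivity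
    linarith

/-- The potential `log (min |z - P| ρ) / s₁ - log (min |z - Q| ρ) / s₂`. It measures the progress of
a curve that leaves the ball of radius `ρ` around `P` and enters the one around `Q`. -/
noncomputable def twoPointPotential (P Q : EuclideanSpace ℝ (Fin n)) (s₁ s₂ ρ : ℝ)
    (z : EuclideanSpace ℝ (Fin n)) : ℝ :=
  Real.log (min (dist z P) ρ) / s₁ - Real.log (min (dist z Q) ρ) / s₂

section Potential

variable {G : Set (EuclideanSpace ℝ (Fin n))} {P Q : EuclideanSpace ℝ (Fin n)} {s₁ s₂ ρ : ℝ}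

theorem continuousOn_twoPointPotential (hP : P ∉ G) (hQ : Q ∉ G) (hρ : 0 < ρ) :
    ContinuousOn (twoPointPotential P Q s₁ s₂ ρ) G := by
  have key : ∀ A ∉ G, ContinuousOn (fun z => Real.log (min (dist z A) ρ)) G := fun A hA =>
    ContinuousOn.log (by fun_prop) fun z hz =>
      (lt_min (dist_pos.2 (ne_of_mem_of_not_mem hz hA)) hρ).ne'
  exact ((key P hP).div_const _).sub ((key Q hQ).div_const _)

/-- Where `d_G(z) ≤ s |z - A|`, the function `log (min |z - A| ρ) / s` increases from `z` with slope at
most `1 / d_G(z)`. -/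
theorem log_min_dist_sub_div_le {A z w : EuclideanSpace ℝ (Fin n)} {s : ℝ} (hs : 0 < s)
    (hρ : 0 < ρ) (hz : 0 < bdryDist G z) (hzA : bdryDist G z ≤ dist z A * s)
    (hw : 0 < dist w A) :
    (Real.log (min (dist w A) ρ) - Real.log (min (dist z A) ρ)) / s
      ≤ dist w z * (bdryDist G z)⁻¹ := by
  have hzA' : 0 < dist z A := pos_of_mul_pos_left (hz.trans_le hzA) hs.le
  calc (Real.log (min (dist w A) ρ) - Real.log (min (dist z A) ρ)) / s
      ≤ (|dist w A - dist z A| / dist z A) / s := by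
        gcongr
        exact log_min_sub_log_min_le hzA' hw hρ
    _ ≤ (dist w z / dist z A) / s := by
        gcongr
        exact abs_dist_sub_le w z A
    _ = dist w z * (dist z A * s)⁻¹ := by field_simp
    _ ≤ dist w z * (bdryDist G z)⁻¹ := by gcongr

/-- The slope of the two-point potential is locally bounded by `1 / d_G`: as the two balls of
radius `ρ` are disjoint, one of its terms is locally constant. -/
theorem twoPointPotential_sub_le (hpos : ∀ z ∈ G, 0 < bdryDist G z) (hs₁ : 0 < s₁) (hs₂ : 0 < s₂)
    (hρ : 0 < ρ) (hPQ : 2 * ρ < dist P Q) (hP : ∀ z ∈ G, bdryDist G z ≤ dist z P * s₁)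
    (hQ : ∀ z ∈ G, bdryDist G z ≤ dist z Q * s₂) {z : EuclideanSpace ℝ (Fin n)} (hz : z ∈ G) :
    ∀ᶠ w in 𝓝[G] z, twoPointPotential P Q s₁ s₂ ρ w - twoPointPotential P Q s₁ s₂ ρ z ≤
      dist w z * max (bdryDist G z)⁻¹ (bdryDist G w)⁻¹ := by
  have hdist : ∀ A : EuclideanSpace ℝ (Fin n), ∀ s : ℝ, 0 < s →
      (∀ z ∈ G, bdryDist G z ≤ dist z A * s) → ∀ w ∈ G, 0 < dist w A := fun A s hs h w hw =>
    pos_of_mul_pos_left ((hpos w hw).trans_le (h w hw)) hs.le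
  have hev : ∀ A : EuclideanSpace ℝ (Fin n), ρ < dist z A → ∀ᶠ w in 𝓝[G] z, ρ < dist w A :=
    fun A hA => nhdsWithin_le_nhds ((by fun_prop : Continuous fun w => dist w A).continuousAt
      |>.eventually (lt_mem_nhds hA))
  by_cases hzP : ρ < dist z P
  · filter_upwards [hev P hzP, self_mem_nhdsWithin] with w hwP hw
    have h := log_min_dist_sub_div_le hs₂ hρ (hpos w hw) (hQ w hw) (hdist Q s₂ hs₂ hQ z hz)
    rw [dist_comm z w, sub_div] at h
    have h' := mul_le_mul_of_nonneg_left (le_max_right (bdryDist G z)⁻¹ (bdryDist G w)⁻¹)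
      (dist_nonneg (x := w) (y := z))
    simp only [twoPointPotential, min_eq_right hwP.le, min_eq_right hzP.le]
    linarith
  · have hzQ : ρ < dist z Q := by
      have := dist_triangle_left P Q z
      linarith
    filter_upwards [hev Q hzQ, self_mem_nhdsWithin] with w hwQ hw
    have h := log_min_dist_sub_div_le hs₁ hρ (hpos z hz) (hP z hz) (hdist P s₁ hs₁ hP w hw)
    rw [sub_div] at h
    have h' := mul_le_mul_of_nonneg_left (le_max_left (bdryDist G z)⁻¹ (bdryDist G w)⁻¹)
      (dist_nonneg (x := w) (y := z))
    simp only [twoPointPotential, min_eq_right hwQ.le, min_eq_right hzQ.le]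
    linarith

end Potential

/-! ### The geometry of the triangle -/

/-- If a vector of the angle spanned by `u` and `v` is on the side of `v` of the bisector, then it is
no farther from the line spanned by `v` than a vector of the same length on the bisector. -/
theorem exists_norm_sub_smul_le {V : Type*} [NormedAddCommGroup V] [InnerProductSpace ℝ V]
    {u v : V} (hv : v ≠ 0) {q r : ℝ} (hq : 0 ≤ q) (hqr : q * ‖u‖ ≤ r * ‖v‖) :
    ∃ c : ℝ, ‖q • u + r • v - c • v‖ ≤
      ‖q • u + r • v‖ * Real.sin (InnerProductGeometry.angle u v / 2) := by
  set θ := InnerProductGeometry.angle u v with hθ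
  have hv' : 0 < ‖v‖ := norm_pos_iff.2 hv
  have hC := InnerProductGeometry.cos_angle_mul_norm_mul_norm u v
  rw [← hθ] at hC
  have hnorm : ∀ a b : ℝ, ‖a • u + b • v‖ ^ 2 =
      a ^ 2 * ‖u‖ ^ 2 + 2 * (a * b * (Real.cos θ * (‖u‖ * ‖v‖))) + b ^ 2 * ‖v‖ ^ 2 := by
    intro a b
    rw [norm_add_sq_real, inner_smul_left, inner_smul_right, norm_smul, norm_smul, mul_pow,
      mul_pow, Real.norm_eq_abs, Real.norm_eq_abs, sq_abs, sq_abs, hC]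
    simp
    ring
  have hsin : 0 ≤ Real.sin (θ / 2) :=
    Real.sin_nonneg_of_nonneg_of_le_pi
      (div_nonneg (InnerProductGeometry.angle_nonneg u v) zero_le_two)
      (by linarith [InnerProductGeometry.angle_le_pi u v, Real.pi_pos])
  have hsq : Real.sin (θ / 2) ^ 2 = (1 - Real.cos θ) / 2 := by
    rw [Real.sin_sq, Real.cos_sq, mul_div_cancel₀ θ two_ne_zero]
    ring
  -- the foot of the perpendicular to the line spanned by `v`
  refine ⟨r + q * ‖u‖ * Real.cos θ / ‖v‖, ?_⟩
  have hsub : q • u + r • v - (r + q * ‖u‖ * Real.cos θ / ‖v‖) • v =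
      q • u + (-(q * ‖u‖ * Real.cos θ / ‖v‖)) • v := by
    module
  rw [hsub]
  refine (sq_le_sq₀ (norm_nonneg _) (mul_nonneg (norm_nonneg _) hsin)).1 ?_
  rw [mul_pow, hnorm, hnorm, hsq]
  have h1 := Real.cos_le_one θ
  have h2 := Real.neg_one_le_cos θ
  have hq' : 0 ≤ q * ‖u‖ := by positivity
  have e : q ^ 2 * ‖u‖ ^ 2 + 2 * (q * -(q * ‖u‖ * Real.cos θ / ‖v‖) * (Real.cos θ * (‖u‖ * ‖v‖)))
      + (-(q * ‖u‖ * Real.cos θ / ‖v‖)) ^ 2 * ‖v‖ ^ 2 =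
      (q * ‖u‖) ^ 2 * (1 - Real.cos θ ^ 2) := by
    field_simp
    ring
  rw [e]
  have h3 : 0 ≤ (1 - Real.cos θ) *
      ((r * ‖v‖ - q * ‖u‖) * (r * ‖v‖ - q * ‖u‖ + 2 * (q * ‖u‖) * (1 + Real.cos θ))) :=
    mul_nonneg (by linarith) (mul_nonneg (by linarith)
      (add_nonneg (by linarith) (mul_nonneg (by linarith) (by linarith))))
  nlinarith [h3]

section Triangle

variable {P Q R : EuclideanSpace ℝ (Fin 2)}

theorem exists_affineBasis_coe_eq (h : AffineIndependent ℝ ![P, Q, R]) :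
    ∃ b : AffineBasis (Fin 3) ℝ (EuclideanSpace ℝ (Fin 2)), ⇑b = ![P, Q, R] :=
  ⟨⟨_, h, h.affineSpan_eq_top_iff_card_eq_finrank_add_one.2 (by simp)⟩, rfl⟩

theorem triangleDomain_eq_setOf_coord_pos {b : AffineBasis (Fin 3) ℝ (EuclideanSpace ℝ (Fin 2))}
    (hb : ⇑b = ![P, Q, R]) : triangleDomain P Q R = {z | ∀ i, 0 < b.coord i z} := by
  rw [← b.interior_convexHull, hb, triangleDomain]
  congr 2
  ext w
  simp [eq_comm]
  tauto

theorem triangleDomain_swap_left (P Q R : EuclideanSpace ℝ (Fin 2)) :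
    triangleDomain Q P R = triangleDomain P Q R := by
  rw [triangleDomain, triangleDomain, Set.insert_comm]

theorem triangleDomain_swap_right (P Q R : EuclideanSpace ℝ (Fin 2)) :
    triangleDomain P R Q = triangleDomain P Q R := by
  rw [triangleDomain, triangleDomain, Set.pair_comm]

theorem lineMap_notMem_triangleDomain (h : AffineIndependent ℝ ![P, Q, R]) (c : ℝ) :
    AffineMap.lineMap P R c ∉ triangleDomain P Q R := by
  obtain ⟨b, hb⟩ := exists_affineBasis_coe_eq h
  rw [triangleDomain_eq_setOf_coord_pos hb]
  intro hc
  have h0 : P = b 0 := by rw [hb]; rfl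
  have h2 : R = b 2 := by rw [hb]; rfl
  have := hc 1
  rw [AffineMap.apply_lineMap, h0, h2, b.coord_apply_ne (by decide), b.coord_apply_ne (by decide)]
    at this
  simp at this

theorem left_notMem_triangleDomain (h : AffineIndependent ℝ ![P, Q, R]) :
    P ∉ triangleDomain P Q R := by
  simpa using lineMap_notMem_triangleDomain h 0

theorem nonempty_triangleDomain (h : AffineIndependent ℝ ![P, Q, R]) :
    (triangleDomain P Q R).Nonempty := by
  obtain ⟨b, hb⟩ := exists_affineBasis_coe_eq h
  rw [triangleDomain_eq_setOf_coord_pos hb]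
  exact ⟨Finset.univ.centroid ℝ b, fun i => by
    rw [b.coord_apply_centroid (Finset.mem_univ i)]; simp⟩

theorem affineIndependent_swap_left (h : AffineIndependent ℝ ![P, Q, R]) :
    AffineIndependent ℝ ![Q, P, R] := by
  rw [← affineIndependent_equiv (Equiv.swap (0 : Fin 3) 1)]
  convert h using 1
  ext i
  fin_cases i <;> rfl

theorem affineIndependent_swap_right (h : AffineIndependent ℝ ![P, Q, R]) :
    AffineIndependent ℝ ![P, R, Q] := by
  rw [← affineIndependent_equiv (Equiv.swap (1 : Fin 3) 2)]
  convert h using 1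
  ext i
  fin_cases i <;> rfl

/-- In a triangle the boundary distance grows away from a vertex at most at the rate attained on
the angle bisector. -/
theorem bdryDist_triangleDomain_le (h : AffineIndependent ℝ ![P, Q, R])
    {z : EuclideanSpace ℝ (Fin 2)} (hz : z ∈ triangleDomain P Q R) :
    bdryDist (triangleDomain P Q R) z ≤
      dist z P * Real.sin (EuclideanGeometry.angle Q P R / 2) := by
  obtain ⟨b, hb⟩ := exists_affineBasis_coe_eq h
  obtain ⟨q, r, hq, hr, hzqr⟩ : ∃ q r : ℝ, 0 < q ∧ 0 < r ∧
      z - P = q • (Q - P) + r • (R - P) := by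
    have hz' := hz
    rw [triangleDomain_eq_setOf_coord_pos hb] at hz'
    refine ⟨_, _, hz' 1, hz' 2, ?_⟩
    have hsum := b.sum_coord_apply_eq_one z
    have hlin := b.linear_combination_coord_eq_self z
    rw [hb] at hlin
    rw [Fin.sum_univ_three] at hsum hlin
    simp only [Matrix.cons_val] at hlin
    nth_rewrite 1 [← hlin]
    rw [← eq_sub_iff_add_eq, ← eq_sub_iff_add_eq'] at hsum
    rw [show b.coord 0 z = 1 - b.coord 1 z - b.coord 2 z by linarith]
    module
  -- the bound when `z` is on the side of `R`; the other case is symmetric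
  have key : ∀ Q R : EuclideanSpace ℝ (Fin 2), AffineIndependent ℝ ![P, Q, R] →
      z ∈ triangleDomain P Q R → ∀ q r : ℝ, 0 < q → 0 < r →
      z - P = q • (Q - P) + r • (R - P) → q * ‖Q - P‖ ≤ r * ‖R - P‖ →
      bdryDist (triangleDomain P Q R) z ≤
        dist z P * Real.sin (EuclideanGeometry.angle Q P R / 2) := by
    intro Q R h hz q r hq hr hzqr hle
    have hRP : R - P ≠ 0 := sub_ne_zero.2 fun hRP => by
      simpa using h.injective.ne (show (2 : Fin 3) ≠ 0 by decide) hRP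
    obtain ⟨c, hc⟩ := exists_norm_sub_smul_le hRP hq.le hle
    refine (bdryDist_le_dist hz (lineMap_notMem_triangleDomain h c)).trans ?_
    rw [EuclideanGeometry.angle, dist_eq_norm z P, hzqr, dist_eq_norm]
    refine le_of_eq_of_le ?_ hc
    rw [← hzqr, AffineMap.lineMap_apply, vsub_eq_sub, vadd_eq_add, sub_sub, add_comm]
  rcases le_total (q * ‖Q - P‖) (r * ‖R - P‖) with hle | hle
  · exact key Q R h hz q r hq hr hzqr hle
  · rw [EuclideanGeometry.angle_comm, ← triangleDomain_swap_right]
    rw [← triangleDomain_swap_right] at hz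
    exact key R Q (affineIndependent_swap_right h) hz r q hr hq (by rw [hzqr, add_comm]) hle

/-- The image of a ball in the triangle under a contraction towards a vertex is in the triangle. -/
theorem ball_lineMap_subset_triangleDomain (h : AffineIndependent ℝ ![P, Q, R])
    {z : EuclideanSpace ℝ (Fin 2)} {r t : ℝ} (hzr : Metric.ball z r ⊆ triangleDomain P Q R)
    (ht : 0 < t) (ht1 : t ≤ 1) :
    Metric.ball (AffineMap.lineMap P z t) (t * r) ⊆ triangleDomain P Q R := by
  obtain ⟨b, hb⟩ := exists_affineBasis_coe_eq h
  intro w hw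
  have hw' : P + t⁻¹ • (w - P) ∈ triangleDomain P Q R := by
    apply hzr
    have e : P + t⁻¹ • (w - P) - z = t⁻¹ • (w - AffineMap.lineMap P z t) := by
      rw [AffineMap.lineMap_apply, vsub_eq_sub, vadd_eq_add, add_comm (t • (z - P)), ← sub_sub,
        smul_sub _ (w - P), inv_smul_smul₀ ht.ne']
      abel
    rw [Metric.mem_ball, dist_eq_norm] at hw ⊢
    rw [e, norm_smul, norm_inv, Real.norm_eq_abs, abs_of_pos ht, inv_mul_lt_iff₀ ht]
    exact hw
  have hwl : w = AffineMap.lineMap P (P + t⁻¹ • (w - P)) t := by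
    rw [AffineMap.lineMap_apply, vsub_eq_sub, vadd_eq_add, add_sub_cancel_left, smul_smul,
      mul_inv_cancel₀ ht.ne', one_smul, sub_add_cancel]
  have h0 : P = b 0 := by rw [hb]; rfl
  rw [triangleDomain_eq_setOf_coord_pos hb] at hw' ⊢
  intro i
  rw [hwl, AffineMap.apply_lineMap, AffineMap.lineMap_apply_ring]
  have hP : 0 ≤ b.coord i P := by
    rw [h0, b.coord_apply]
    split_ifs <;> norm_num
  exact add_pos_of_nonneg_of_pos (mul_nonneg (by linarith) hP) (mul_pos ht (hw' i))

/-! ### The uniformity constant -/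

/-- The growth comparison behind the theorem: as the contraction ratio `exp (-L)` tends to `0`, the
potential difference between the two points, hence their quasihyperbolic distance, is at least
`(1 / sin (α / 2) + 1 / sin (β / 2)) L - O(1)`, and their distance ratio is at most `L + O(1)`. -/
theorem eventually_mul_le_of_qhDist_le (h : AffineIndependent ℝ ![P, Q, R]) {A : ℝ} (hA : 1 ≤ A)
    (hk : ∀ x ∈ triangleDomain P Q R, ∀ y ∈ triangleDomain P Q R,
      qhDist (triangleDomain P Q R) x y ≤
        ENNReal.ofReal (A * distRatio (triangleDomain P Q R) x y)) :
    ∃ C : ℝ, ∀ᶠ L : ℝ in atTop,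
      (1 / Real.sin (EuclideanGeometry.angle Q P R / 2) +
        1 / Real.sin (EuclideanGeometry.angle P Q R / 2)) * L ≤ A * L + C := by
  set T := triangleDomain P Q R with hT
  set s₁ := Real.sin (EuclideanGeometry.angle Q P R / 2) with hs₁
  set s₂ := Real.sin (EuclideanGeometry.angle P Q R / 2) with hs₂
  have h' := affineIndependent_swap_left h
  have hTo : IsOpen T := isOpen_interior
  have hPT : P ∉ T := left_notMem_triangleDomain h
  have hQT : Q ∉ T := by
    rw [hT, ← triangleDomain_swap_left]
    exact left_notMem_triangleDomain h'
  have hpos : ∀ z ∈ T, 0 < bdryDist T z := fun z hz => bdryDist_pos hTo hz hPT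
  have hP : ∀ z ∈ T, bdryDist T z ≤ dist z P * s₁ := fun z hz => bdryDist_triangleDomain_le h hz
  have hQ : ∀ z ∈ T, bdryDist T z ≤ dist z Q * s₂ := by
    intro z hz
    rw [hT, ← triangleDomain_swap_left] at hz ⊢
    exact bdryDist_triangleDomain_le h' hz
  obtain ⟨z, hz⟩ := nonempty_triangleDomain h
  obtain ⟨r, hr, hzr⟩ := Metric.isOpen_iff.1 hTo z hz
  have hs₁0 : 0 < s₁ := pos_of_mul_pos_right ((hpos z hz).trans_le (hP z hz)) dist_nonneg
  have hs₂0 : 0 < s₂ := pos_of_mul_pos_right ((hpos z hz).trans_le (hQ z hz)) dist_nonneg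
  have hzP : 0 < dist z P := dist_pos.2 fun e => hPT (e ▸ hz)
  have hzQ : 0 < dist z Q := dist_pos.2 fun e => hQT (e ▸ hz)
  have hD : 0 < dist P Q := dist_pos.2 fun e => by
    simpa using h.injective.ne (show (0 : Fin 3) ≠ 1 by decide) e
  set ρ := dist P Q / 3 with hρ
  have hρ0 : 0 < ρ := by positivity
  refine ⟨A * Real.log (1 + dist P Q / r) - (Real.log ρ / s₁ - Real.log (dist z Q) / s₂) +
    (Real.log (dist z P) / s₁ - Real.log ρ / s₂), ?_⟩
  have hsmall : ∀ B : ℝ, ∀ᶠ L : ℝ in atTop, Real.exp (-L) * B < ρ := fun B => by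
    have : Tendsto (fun L : ℝ => Real.exp (-L) * B) atTop (𝓝 (0 * B)) :=
      (Real.tendsto_exp_atBot.comp tendsto_neg_atTop_atBot).mul_const B
    rw [zero_mul] at this
    exact this.eventually (gt_mem_nhds hρ0)
  filter_upwards [hsmall (dist z P), hsmall (dist z Q), eventually_ge_atTop 0] with L hLP hLQ hL
  set t := Real.exp (-L) with ht
  have ht0 : 0 < t := Real.exp_pos _
  have ht1 : t ≤ 1 := Real.exp_le_one_iff.2 (by linarith)
  have hlogt : Real.log t = -L := Real.log_exp _
  set x := AffineMap.lineMap P z t with hx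
  set y := AffineMap.lineMap Q z t with hy
  have hxb : Metric.ball x (t * r) ⊆ T := ball_lineMap_subset_triangleDomain h hzr ht0 ht1
  have hyb : Metric.ball y (t * r) ⊆ T := by
    rw [hT, ← triangleDomain_swap_left] at hzr ⊢
    exact ball_lineMap_subset_triangleDomain h' hzr ht0 ht1
  have htr : 0 < t * r := mul_pos ht0 hr
  have hxT : x ∈ T := hxb (Metric.mem_ball_self htr)
  have hyT : y ∈ T := hyb (Metric.mem_ball_self htr)
  have hxP : dist x P = t * dist z P := by
    rw [hx, dist_lineMap_left, Real.norm_eq_abs, abs_of_pos ht0, dist_comm P]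
  have hyQ : dist y Q = t * dist z Q := by
    rw [hy, dist_lineMap_left, Real.norm_eq_abs, abs_of_pos ht0, dist_comm Q]
  have hxQ : ρ ≤ dist x Q := by
    have := dist_triangle_left P Q x
    linarith
  have hyP : ρ ≤ dist y P := by
    have := dist_triangle_left P Q y
    linarith
  have hUx : twoPointPotential P Q s₁ s₂ ρ x =
      (-L + Real.log (dist z P)) / s₁ - Real.log ρ / s₂ := by
    rw [twoPointPotential, min_eq_right hxQ, hxP, min_eq_left hLP.le,
      Real.log_mul ht0.ne' hzP.ne', hlogt]
  have hUy : twoPointPotential P Q s₁ s₂ ρ y =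
      Real.log ρ / s₁ - (-L + Real.log (dist z Q)) / s₂ := by
    rw [twoPointPotential, min_eq_right hyP, hyQ, min_eq_left hLQ.le,
      Real.log_mul ht0.ne' hzQ.ne', hlogt]
  have hj0 : 0 ≤ distRatio T x y :=
    Real.log_nonneg (le_add_of_nonneg_right (div_nonneg (norm_nonneg _)
      (le_min (hpos x hxT).le (hpos y hyT).le)))
  have hj : distRatio T x y ≤ Real.log (1 + dist P Q / r) + L := by
    have hxy : ‖x - y‖ ≤ dist P Q := by
      have e : x - y = (1 - t) • (P - Q) := by
        rw [hx, hy, AffineMap.lineMap_apply_module, AffineMap.lineMap_apply_module]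
        module
      rw [e, norm_smul, Real.norm_eq_abs, abs_of_nonneg (by linarith), dist_eq_norm]
      exact mul_le_of_le_one_left (norm_nonneg _) (by linarith)
    have hmin : t * r ≤ min (bdryDist T x) (bdryDist T y) :=
      le_min (le_bdryDist_of_ball_subset htr hxb hPT) (le_bdryDist_of_ball_subset htr hyb hPT)
    have hpos' : 0 < 1 + dist P Q / r := by positivity
    calc distRatio T x y ≤ Real.log ((1 + dist P Q / r) / t) := by
          have : 0 < min (bdryDist T x) (bdryDist T y) := htr.trans_le hmin
          refine Real.log_le_log (by positivity) ?_
          calc 1 + ‖x - y‖ / min (bdryDist T x) (bdryDist T y)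
              ≤ 1 / t + dist P Q / (t * r) := by
                gcongr
                exact (one_le_div ht0).2 ht1
            _ = (1 + dist P Q / r) / t := by field_simp
      _ = Real.log (1 + dist P Q / r) + L := by
          rw [Real.log_div hpos'.ne' ht0.ne', hlogt, sub_neg_eq_add]
  have hU : ENNReal.ofReal (twoPointPotential P Q s₁ s₂ ρ y - twoPointPotential P Q s₁ s₂ ρ x) ≤
      qhDist T x y := by
    refine le_sInf ?_
    rintro _ ⟨γ, hγT, hγ, rfl⟩
    exact ofReal_sub_le_qhLength hγ hγT hpos (continuousOn_twoPointPotential hPT hQT hρ0)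
      fun w hw => twoPointPotential_sub_le hpos hs₁0 hs₂0 hρ0 (by linarith) hP hQ hw
  have hfin := (ENNReal.ofReal_le_ofReal_iff (mul_nonneg (by linarith) hj0)).1
    (hU.trans (hk x hxT y hyT))
  have hAj : A * distRatio T x y ≤ A * (Real.log (1 + dist P Q / r) + L) :=
    mul_le_mul_of_nonneg_left hj (by linarith)
  rw [hUx, hUy] at hfin
  have e : (1 / s₁ + 1 / s₂) * L = Real.log ρ / s₁ - (-L + Real.log (dist z Q)) / s₂ -
      ((-L + Real.log (dist z P)) / s₁ - Real.log ρ / s₂) -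
      (Real.log ρ / s₁ - Real.log (dist z Q) / s₂) +
      (Real.log (dist z P) / s₁ - Real.log ρ / s₂) := by ring
  rw [e]
  linarith

end Triangle

theorem le_of_eventually_mul_le_mul_add {a b C : ℝ}
    (h : ∀ᶠ L : ℝ in atTop, a * L ≤ b * L + C) : a ≤ b := by
  by_contra! hab
  have ht : Tendsto (fun L : ℝ => (a - b) * L) atTop atTop :=
    tendsto_id.const_mul_atTop (sub_pos.2 hab)
  obtain ⟨L, h1, h2⟩ := (h.and (ht.eventually_gt_atTop C)).exists
  linarith

end QuasihyperbolicUC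

theorem theorem1p7 (P Q R : EuclideanSpace ℝ (Fin 2)) (hPQR : AffineIndependent ℝ ![P, Q, R])
    (α β γ : ℝ) (hα : α = EuclideanGeometry.angle Q P R) (hβ : β = EuclideanGeometry.angle P Q R)
    (hγ : γ = EuclideanGeometry.angle P R Q) (hαβ : α ≤ β) (hβγ : β ≤ γ) :
    ((1 / Real.sin (α / 2) + 1 / Real.sin (β / 2) : ℝ) : EReal) ≤
      QuasihyperbolicUC.uniformityConstant (QuasihyperbolicUC.triangleDomain P Q R) := by
  subst hα hβ
  refine le_sInf ?_
  rintro _ ⟨A, hA, hk, rfl⟩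
  obtain ⟨C, hC⟩ := QuasihyperbolicUC.eventually_mul_le_of_qhDist_le hPQR hA hk
  exact EReal.coe_le_coe_iff.2 (QuasihyperbolicUC.le_of_eventually_mul_le_mul_add hC)
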